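/- Let $p_d,p_e\in[0,1]$. In the i.i.d. binary deletion–substitution channel each transmitted bit is, independently, deleted with probability $p_d$; each undeleted bit is, independently, flipped with probability $p_e$; the remaining bits are received in order, and neither the transmitter nor the receiver is told the positions of deletions or flips. Write $\log=\log_2$ with $0\log 0=0$, and let $$C_{ds}=\lim_{N\to\infty}\frac1N\max_{P(\mathbf X)}I(\mathbf X;\mathbf Y)$$ be its (information) capacity in bits per channel use, where $\mathbf X\in\{0,1\}^N$ is the transmitted block, $\mathbf Y$ is the received sequence, and the maximum is over all probability distributions of $\mathbf X$. This limit exists, and for every integer $n>0$, $$C_{ds}\ \geq\ 1-p_d-H_b(p_d)+\frac1n\sum_{j=1}^n W_j(n)\binom nj p_d^j(1-p_d)^{n-j}-(1-p_d)H_b(p_e),$$ where $H_b(p)=-p\log p-(1-p)\log(1-p)$ and $$W_j(n)=\frac1{\binom nj}\left(\sum_{l=1}^{n-1}2^{-l-1}(n-l+3)\sum_{j'=1}^{j}\binom l{j'}\binom{n-l}{j-j'}\log\binom l{j'}\right)+2^{-n+1}\log\binom nj .$$ Terms with $\binom{l}{j'}=0$ are read as $0$. -/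

import Mathlib

noncomputable section

namespace DelSub

/-- Probability mass function of a `{true, false}`-valued Bernoulli variable:
`true` has probability `p`, `false` has probability `1 - p`. -/
def bern (p : ℝ) (b : Bool) : ℝ := if b then p else 1 - p

/-- The sequence received when the block `x` is transmitted: bit `i` is deleted if `d i = true`;
otherwise it is received, flipped if `e i = true`. Received bits keep their order, and the
receiver gets only this list (no marks at deleted or flipped positions). -/
def received {N : ℕ} (x d e : Fin N → Bool) : List Bool :=
  ((List.finRange N).filter (fun i => !d i)).map (fun i => xor (x i) (e i))

/-- Transition probability `P(y | x)` of `N` uses of the i.i.d. deletion-substitution channel: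
the bits are deleted independently with probability `pd`, and the undeleted bits are flipped
independently with probability `pe`. -/
def transition (pd pe : ℝ) {N : ℕ} (x : Fin N → Bool) (y : List Bool) : ℝ :=
  ∑ d : Fin N → Bool, ∑ e : Fin N → Bool,
    if received x d e = y then (∏ i, bern pd (d i)) * ∏ i, bern pe (e i) else 0

/-- All possible received sequences: the binary sequences of length at most `N`. -/
def outputs (N : ℕ) : Finset (List Bool) :=
  (Finset.range (N + 1)).biUnion fun m =>
    (Finset.univ : Finset (Fin m → Bool)).image List.ofFn

/-- The entropy summand `- p log₂ p` (with `0 log₂ 0 = 0`). -/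
def entropyTerm (p : ℝ) : ℝ := -(p * Real.logb 2 p)

/-- `P(y) = ∑ₓ P(x) P(y | x)`. -/
def outputProb (pd pe : ℝ) {N : ℕ} (P : (Fin N → Bool) → ℝ) (y : List Bool) : ℝ :=
  ∑ x, P x * transition pd pe x y

/-- The output entropy `H(Y)` in bits, for the input distribution `P`. -/
def outputEntropy (pd pe : ℝ) {N : ℕ} (P : (Fin N → Bool) → ℝ) : ℝ :=
  ∑ y ∈ outputs N, entropyTerm (outputProb pd pe P y)

/-- The conditional output entropy `H(Y | X)` in bits, for the input distribution `P`. -/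
def condEntropy (pd pe : ℝ) {N : ℕ} (P : (Fin N → Bool) → ℝ) : ℝ :=
  ∑ x, P x * ∑ y ∈ outputs N, entropyTerm (transition pd pe x y)

/-- The mutual information `I(X; Y) = H(Y) - H(Y | X)` in bits. -/
def mutualInfo (pd pe : ℝ) {N : ℕ} (P : (Fin N → Bool) → ℝ) : ℝ :=
  outputEntropy pd pe P - condEntropy pd pe P

/-- The maximum of `I(X; Y)` over all distributions of the input block of length `N`. It is
attained, see `isGreatest_maxMutualInfo`. -/
def maxMutualInfo (pd pe : ℝ) (N : ℕ) : ℝ :=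
  sSup (mutualInfo pd pe '' stdSimplex ℝ (Fin N → Bool))

/-- The capacity of the i.i.d. deletion-substitution channel, in bits per channel use:
the limit as `N → ∞` of `(1 / N) max_{P(X)} I(X; Y)`. -/
def capacity (pd pe : ℝ) : ℝ :=
  Filter.limUnder Filter.atTop fun N : ℕ => (1 / (N : ℝ)) * maxMutualInfo pd pe N

/-- The binary entropy function, in bits. -/
def Hb (p : ℝ) : ℝ := -p * Real.logb 2 p - (1 - p) * Real.logb 2 (1 - p)

/-- The quantity `W_j(n)`. -/
def W (j n : ℕ) : ℝ :=
  (1 / (n.choose j : ℝ)) *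
      (∑ l ∈ Finset.Icc 1 (n - 1), (2 : ℝ) ^ (-(l : ℤ) - 1) * ((n : ℝ) - l + 3) *
        ∑ j' ∈ Finset.Icc 1 j,
          (l.choose j' : ℝ) * ((n - l).choose (j - j') : ℝ) * Real.logb 2 (l.choose j'))
    + (2 : ℝ) ^ (-(n : ℤ) + 1) * Real.logb 2 (n.choose j)

theorem continuous_entropyTerm : Continuous entropyTerm := by
  have h : entropyTerm = fun p => Real.negMulLog p / Real.log 2 := by
    funext p
    simp only [entropyTerm, Real.negMulLog, Real.logb]
    ring
  rw [h]
  exact Real.continuous_negMulLog.div_const _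

theorem continuous_mutualInfo (pd pe : ℝ) (N : ℕ) :
    Continuous (mutualInfo pd pe : ((Fin N → Bool) → ℝ) → ℝ) := by
  have := continuous_entropyTerm
  unfold mutualInfo outputEntropy condEntropy outputProb
  fun_prop

/-- The maximal mutual information is an attained maximum. -/
theorem isGreatest_maxMutualInfo (pd pe : ℝ) (N : ℕ) :
    IsGreatest (mutualInfo pd pe '' stdSimplex ℝ (Fin N → Bool)) (maxMutualInfo pd pe N) :=
  ((isCompact_stdSimplex ℝ (Fin N → Bool)).image (continuous_mutualInfo pd pe N)).isGreatest_sSup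
    (Set.Nonempty.image _ ⟨_, single_mem_stdSimplex ℝ (fun _ => false)⟩)

end DelSub

end

namespace DelSub

/-! The bound comes from uniform inputs, with `I(X;Y) = H(Y) - H(Y|X)`. Under a uniform block every
received bit is a fair coin, so `P(y) ≤ 2^{-|y|}` and `H(Y) ≥ E|Y| = (1 - pd) N`
(`le_sum_entropyTerm_avg_law`).

For `H(Y|X)`, cutting the input in two makes `Y` the concatenation of two independent outputs.
Concatenation only merges outcomes, so `H(Y|X = x)` is subadditive in `x` (`lawEntropy_append_le`).
Used across blocks of length `n`, this bounds the limiting rate by the value at `n`. Used inside a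
block, it cuts `x` into runs. The output law of one run is explicit, with entropy `r (Hb pd + (1 -
pd) Hb pe) - E log₂ (r.choose D)`, where `D` counts the deletions (`lawEntropy_replicate`). A
uniform block of length `n` has on average `2^{-l-1}(n - l + 3)` runs of length `l < n` and
`2^{-n+1}` of length `n` (`avg_lawEntropy_le`). Conditioning on the total number of deletions turns
the result into the `W j n` (`sum_W_mul`).

The limit exists by Fekete's lemma: telling the receiver where the output is cut can only help, and
then the two halves are separate channels (`subadditive_maxMutualInfo`). -/

/-! ### Entropy inequalities -/

theorem entropyTerm_mul (a b : ℝ) :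
    entropyTerm (a * b) = b * entropyTerm a + a * entropyTerm b := by
  rcases eq_or_ne a 0 with rfl | ha
  · simp [entropyTerm]
  rcases eq_or_ne b 0 with rfl | hb
  · simp [entropyTerm]
  rw [entropyTerm, Real.logb_mul ha hb, entropyTerm, entropyTerm]
  ring

/-- The log-sum inequality. -/
theorem log_sum_inequality {ι : Type*} (s : Finset ι) (a b : ι → ℝ)
    (ha : ∀ i ∈ s, 0 ≤ a i) (hb : ∀ i ∈ s, 0 ≤ b i) (hab : ∀ i ∈ s, b i = 0 → a i = 0) :
    (∑ i ∈ s, a i) * Real.logb 2 (∑ i ∈ s, a i) - (∑ i ∈ s, a i) * Real.logb 2 (∑ i ∈ s, b i) ≤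
      ∑ i ∈ s, (a i * Real.logb 2 (a i) - a i * Real.logb 2 (b i)) := by
  set A := ∑ i ∈ s, a i with hA
  set B := ∑ i ∈ s, b i with hB
  rcases (Finset.sum_nonneg ha).eq_or_lt with h0 | hApos
  · have h0' := (Finset.sum_eq_zero_iff_of_nonneg ha).1 h0.symm
    rw [← hA] at h0
    rw [← h0, Finset.sum_eq_zero]
    · simp
    · intro i hi
      simp [h0' i hi]
  have hBpos : 0 < B := by
    refine (Finset.sum_nonneg hb).lt_of_ne fun h0 => ?_
    have h0' := (Finset.sum_eq_zero_iff_of_nonneg hb).1 h0.symm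
    exact hApos.ne' (Finset.sum_eq_zero fun i hi => hab i hi (h0' i hi))
  rw [← hA] at hApos
  have hl2 : 0 < Real.log 2 := Real.log_pos one_lt_two
  -- This is `log t ≤ t - 1` at `t = b i * A / (a i * B)`; the added terms sum to `A - B * (A / B) =
  -- 0`.
  have key : ∀ i ∈ s, a i * Real.logb 2 A - a i * Real.logb 2 B +
      (a i - b i * (A / B)) / Real.log 2 ≤
      a i * Real.logb 2 (a i) - a i * Real.logb 2 (b i) := by
    intro i hi
    rcases (ha i hi).eq_or_lt with h | h
    · rw [← h]
      have : 0 ≤ b i * (A / B) / Real.log 2 := by have := hb i hi; positivity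
      simp only [zero_mul, zero_sub, neg_div]
      linarith
    · have hbi : 0 < b i := (hb i hi).lt_of_ne fun h' => h.ne' (hab i hi h'.symm)
      have := Real.log_le_sub_one_of_pos (x := b i * A / (a i * B)) (by positivity)
      rw [Real.log_div (by positivity) (by positivity), Real.log_mul hbi.ne' hApos.ne',
        Real.log_mul h.ne' hBpos.ne'] at this
      have h2 := mul_le_mul_of_nonneg_left this h.le
      have h3 : a i * (b i * A / (a i * B) - 1) = b i * (A / B) - a i := by field_simp
      rw [h3] at h2
      have h4 := div_le_div_of_nonneg_right h2 hl2.le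
      simp only [Real.logb]
      have e : ∀ x y z w : ℝ, a i * (x + y - (z + w)) / Real.log 2 =
        a i * (x / Real.log 2) + a i * (y / Real.log 2) - a i * (z / Real.log 2)
          - a i * (w / Real.log 2) := by intros; ring
      rw [e, sub_div] at h4
      rw [sub_div]
      linarith
  refine le_trans (le_of_eq ?_) (Finset.sum_le_sum key)
  rw [Finset.sum_add_distrib, Finset.sum_sub_distrib, ← Finset.sum_div, Finset.sum_sub_distrib,
    ← Finset.sum_mul, ← Finset.sum_mul, ← Finset.sum_mul, ← hA, ← hB]
  field_simp
  ring

/-- Merging outcomes does not increase entropy. -/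
theorem entropyTerm_sum_le {α : Type*} (s : Finset α) (q : α → ℝ) (hq : ∀ a ∈ s, 0 ≤ q a) :
    entropyTerm (∑ a ∈ s, q a) ≤ ∑ a ∈ s, entropyTerm (q a) := by
  rw [entropyTerm, Finset.sum_mul, ← Finset.sum_neg_distrib]
  refine Finset.sum_le_sum fun a ha => ?_
  rcases (hq a ha).eq_or_lt with h | h
  · simp [entropyTerm, ← h]
  · rw [entropyTerm, neg_le_neg_iff]
    exact mul_le_mul_of_nonneg_left
      (Real.logb_le_logb_of_le one_lt_two h (Finset.single_le_sum hq ha)) h.le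

/-- The entropy lost by merging outcomes is concave in the distribution. -/
theorem entropyTerm_sum_concave {ι α : Type*} (t : Finset ι) (s : Finset α) (P : ι → ℝ)
    (q : ι → α → ℝ) (hP : ∀ i ∈ t, 0 ≤ P i) (hq : ∀ i, ∀ a ∈ s, 0 ≤ q i a) :
    entropyTerm (∑ i ∈ t, P i * ∑ a ∈ s, q i a) - ∑ i ∈ t, P i * entropyTerm (∑ a ∈ s, q i a) ≤
      ∑ a ∈ s, entropyTerm (∑ i ∈ t, P i * q i a)
        - ∑ i ∈ t, P i * ∑ a ∈ s, entropyTerm (q i a) := by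
  -- Log-sum inequality over the inputs for a fixed outcome `a`; the weight `P i` cancels inside the
  -- logarithms.
  have key : ∀ a ∈ s,
      (∑ i ∈ t, P i * q i a) * Real.logb 2 (∑ i ∈ t, P i * q i a)
        - (∑ i ∈ t, P i * q i a) * Real.logb 2 (∑ i ∈ t, P i * ∑ a ∈ s, q i a) ≤
      ∑ i ∈ t, (P i * (q i a * Real.logb 2 (q i a))
        - P i * (q i a * Real.logb 2 (∑ a ∈ s, q i a))) := by
    intro a ha
    refine (log_sum_inequality t (fun i => P i * q i a) (fun i => P i * ∑ a ∈ s, q i a)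
      (fun i hi => mul_nonneg (hP i hi) (hq i a ha))
      (fun i hi => mul_nonneg (hP i hi) (Finset.sum_nonneg (hq i))) ?_).trans (le_of_eq ?_)
    · intro i hi h
      rcases mul_eq_zero.1 h with h | h
      · simp [h]
      · simp [(Finset.sum_eq_zero_iff_of_nonneg (hq i)).1 h a ha]
    · refine Finset.sum_congr rfl fun i hi => ?_
      rcases eq_or_ne (P i) 0 with h | h
      · simp [h]
      rcases eq_or_ne (q i a) 0 with h' | h'
      · simp [h']
      have h'' : ∑ a ∈ s, q i a ≠ 0 := fun h0 =>
        h' ((Finset.sum_eq_zero_iff_of_nonneg (hq i)).1 h0 a ha)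
      rw [Real.logb_mul h h', Real.logb_mul h h'']
      ring
  have h := Finset.sum_le_sum key
  rw [Finset.sum_sub_distrib, ← Finset.sum_mul, Finset.sum_comm (s := s) (t := t),
    Finset.sum_comm (s := s) (t := t)] at h
  simp only [Finset.sum_sub_distrib, ← Finset.mul_sum, ← Finset.sum_mul] at h
  simp only [entropyTerm, Finset.sum_neg_distrib, mul_neg]
  linarith

/-- Data processing: applying a function `f` to the output does not increase mutual information. -/
theorem mutualInfo_map_le {ι α β : Type*} [DecidableEq β] (t : Finset ι) (s : Finset α)
    (u : Finset β) (f : α → β) (hf : ∀ a ∈ s, f a ∈ u) (P : ι → ℝ) (q : ι → α → ℝ)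
    (hP : ∀ i ∈ t, 0 ≤ P i) (hq : ∀ i, ∀ a ∈ s, 0 ≤ q i a) :
    ∑ y ∈ u, entropyTerm (∑ i ∈ t, P i * ∑ a ∈ s with f a = y, q i a)
        - ∑ i ∈ t, P i * ∑ y ∈ u, entropyTerm (∑ a ∈ s with f a = y, q i a) ≤
      ∑ a ∈ s, entropyTerm (∑ i ∈ t, P i * q i a)
        - ∑ i ∈ t, P i * ∑ a ∈ s, entropyTerm (q i a) := by
  have key := Finset.sum_le_sum fun y (_ : y ∈ u) =>
    entropyTerm_sum_concave t (s.filter fun a => f a = y) P q hP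
      fun i a ha => hq i a (Finset.mem_filter.1 ha).1
  rw [Finset.sum_sub_distrib, Finset.sum_sub_distrib, Finset.sum_comm (s := u) (t := t),
    Finset.sum_comm (s := u) (t := t)] at key
  simp only [← Finset.mul_sum] at key
  simpa only [Finset.sum_fiberwise_of_maps_to hf] using key

/-- The entropy of a pair is at most the sum of the entropies of its components. -/
theorem sum_entropyTerm_prod_le {α β : Type*} (s : Finset α) (t : Finset β) (Q : α → β → ℝ)
    (hQ : ∀ a ∈ s, ∀ b ∈ t, 0 ≤ Q a b) (h1 : ∑ a ∈ s, ∑ b ∈ t, Q a b = 1) :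
    ∑ a ∈ s, ∑ b ∈ t, entropyTerm (Q a b) ≤
      ∑ a ∈ s, entropyTerm (∑ b ∈ t, Q a b) + ∑ b ∈ t, entropyTerm (∑ a ∈ s, Q a b) := by
  have hn1 : ∀ a ∈ s, 0 ≤ ∑ b ∈ t, Q a b := fun a ha => Finset.sum_nonneg (hQ a ha)
  have hn2 : ∀ b ∈ t, 0 ≤ ∑ a ∈ s, Q a b := fun b hb => Finset.sum_nonneg fun a ha => hQ a ha b hb
  have h1' : ∑ b ∈ t, ∑ a ∈ s, Q a b = 1 := by rw [Finset.sum_comm, h1]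
  have z1 : ∀ a ∈ s, ∀ b ∈ t, ∑ b ∈ t, Q a b = 0 → Q a b = 0 := fun a ha b hb h =>
    (Finset.sum_eq_zero_iff_of_nonneg (hQ a ha)).1 h b hb
  have z2 : ∀ a ∈ s, ∀ b ∈ t, ∑ a ∈ s, Q a b = 0 → Q a b = 0 := fun a ha b hb h =>
    (Finset.sum_eq_zero_iff_of_nonneg fun a ha => hQ a ha b hb).1 h a ha
  -- Joint law against the product of its marginals: both have mass 1, so this says that relative
  -- entropy is nonnegative.
  have key := log_sum_inequality (s ×ˢ t) (fun p => Q p.1 p.2)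
    (fun p => (∑ b ∈ t, Q p.1 b) * ∑ a ∈ s, Q a p.2)
    (fun p hp => hQ _ (Finset.mem_product.1 hp).1 _ (Finset.mem_product.1 hp).2)
    (fun p hp => mul_nonneg (hn1 _ (Finset.mem_product.1 hp).1)
      (hn2 _ (Finset.mem_product.1 hp).2))
    (fun p hp h => by
      obtain ⟨ha, hb⟩ := Finset.mem_product.1 hp
      rcases mul_eq_zero.1 h with h | h
      · exact z1 _ ha _ hb h
      · exact z2 _ ha _ hb h)
  simp only [Finset.sum_product] at key
  rw [h1] at key
  simp only [← Finset.mul_sum] at key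
  simp only [h1', mul_one, h1, sub_self] at key
  have e : ∀ a ∈ s, ∀ b ∈ t, Q a b * Real.logb 2 (Q a b)
        - Q a b * Real.logb 2 ((∑ b ∈ t, Q a b) * ∑ a ∈ s, Q a b) =
      Q a b * Real.logb 2 (Q a b) - (Q a b * Real.logb 2 (∑ b ∈ t, Q a b)
        + Q a b * Real.logb 2 (∑ a ∈ s, Q a b)) := by
    intro a ha b hb
    rcases eq_or_ne (Q a b) 0 with h | h
    · simp [h]
    rw [Real.logb_mul (mt (z1 a ha b hb) h) (mt (z2 a ha b hb) h)]
    ring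
  rw [Finset.sum_congr rfl fun a ha => Finset.sum_congr rfl (e a ha)] at key
  simp only [Finset.sum_sub_distrib, Finset.sum_add_distrib] at key
  rw [Finset.sum_comm (f := fun a b => Q a b * Real.logb 2 (∑ a ∈ s, Q a b))] at key
  simp only [← Finset.sum_mul] at key
  simp only [entropyTerm, Finset.sum_neg_distrib]
  linarith

/-! ### The channel as a recursion on the transmitted list -/

/-- The expectation of `F Y` over the received sequence `Y` when the list `x` is transmitted. -/
noncomputable def expect (pd pe : ℝ) : List Bool → (List Bool → ℝ) → ℝ
  | [], F => F []
  | b :: x, F => pd * expect pd pe x F +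
      (1 - pd) * (pe * expect pd pe x (fun y => F ((!b) :: y)) +
        (1 - pe) * expect pd pe x (fun y => F (b :: y)))

/-- The transition probability `P(y | x)` for a transmitted list `x`. -/
noncomputable def law (pd pe : ℝ) (x y : List Bool) : ℝ :=
  expect pd pe x fun z => if z = y then 1 else 0

/-- The entropy of the output when the list `x` is transmitted. -/
noncomputable def lawEntropy (pd pe : ℝ) (x : List Bool) : ℝ :=
  ∑ y ∈ outputs x.length, entropyTerm (law pd pe x y)

section expect

variable (pd pe : ℝ)

theorem expect_add (x : List Bool) (F G : List Bool → ℝ) :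
    expect pd pe x (fun y => F y + G y) = expect pd pe x F + expect pd pe x G := by
  induction x generalizing F G with
  | nil => rfl
  | cons b x ih =>
    simp only [expect, ih]
    ring

theorem expect_const_mul (x : List Bool) (a : ℝ) (F : List Bool → ℝ) :
    expect pd pe x (fun y => a * F y) = a * expect pd pe x F := by
  induction x generalizing F with
  | nil => rfl
  | cons b x ih =>
    simp only [expect, ih]
    ring

theorem expect_const (x : List Bool) (a : ℝ) : expect pd pe x (fun _ => a) = a := by
  induction x with
  | nil => rfl
  | cons b x ih =>
    simp only [expect, ih]
    ring

theorem expect_append (u v : List Bool) (F : List Bool → ℝ) :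
    expect pd pe (u ++ v) F = expect pd pe u fun y => expect pd pe v fun z => F (y ++ z) := by
  induction u generalizing F with
  | nil => rfl
  | cons b u ih =>
    simp only [List.cons_append, expect, ih]

variable {pd pe}

theorem expect_nonneg (hpd : pd ∈ Set.Icc (0 : ℝ) 1) (hpe : pe ∈ Set.Icc (0 : ℝ) 1)
    (x : List Bool) {F : List Bool → ℝ} (hF : ∀ y, 0 ≤ F y) : 0 ≤ expect pd pe x F := by
  induction x generalizing F with
  | nil => exact hF _
  | cons b x ih =>
    obtain ⟨h1, h2⟩ := hpd
    obtain ⟨h3, h4⟩ := hpe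
    have a1 := ih hF
    have a2 := ih fun y => hF ((!b) :: y)
    have a3 := ih fun y => hF (b :: y)
    have h2' := sub_nonneg.2 h2
    have h4' := sub_nonneg.2 h4
    simp only [expect]
    positivity

theorem law_nonneg (hpd : pd ∈ Set.Icc (0 : ℝ) 1) (hpe : pe ∈ Set.Icc (0 : ℝ) 1)
    (x y : List Bool) : 0 ≤ law pd pe x y :=
  expect_nonneg hpd hpe x fun z => by split_ifs <;> norm_num

variable (pd pe)

theorem law_nil (y : List Bool) : law pd pe [] y = if y = [] then 1 else 0 := by
  simp only [law, expect, eq_comm]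

theorem law_cons_nil (b : Bool) (x : List Bool) :
    law pd pe (b :: x) [] = pd * law pd pe x [] := by
  simp [law, expect, expect_const]

theorem law_cons_cons (b c : Bool) (x y : List Bool) :
    law pd pe (b :: x) (c :: y) =
      pd * law pd pe x (c :: y) + (1 - pd) * (bern pe (xor b c) * law pd pe x y) := by
  cases b <;> cases c <;> simp [law, expect, expect_const, bern]

end expect

theorem mem_outputs {N : ℕ} {y : List Bool} : y ∈ outputs N ↔ y.length ≤ N := by
  simp only [outputs, Finset.mem_biUnion, Finset.mem_range, Finset.mem_image, Finset.mem_univ,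
    true_and]
  constructor
  · rintro ⟨m, hm, z, rfl⟩
    simp
    omega
  · intro h
    exact ⟨y.length, by omega, y.get, by simp⟩

theorem sum_fin_succ_arrow {M : Type*} [AddCommMonoid M] {N : ℕ} (f : (Fin (N + 1) → Bool) → M) :
    ∑ x, f x = ∑ c, ∑ x : Fin N → Bool, f (Fin.cons c x) := by
  rw [← Fintype.sum_prod_type']
  exact (Fintype.sum_equiv (Fin.consEquiv fun _ => Bool) _ _ fun _ => rfl).symm

theorem received_cons {N : ℕ} (b s t : Bool) (x d e : Fin N → Bool) :
    received (Fin.cons b x : Fin (N + 1) → Bool) (Fin.cons s d) (Fin.cons t e) =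
      if s then received x d e else xor b t :: received x d e := by
  cases s <;> simp [received, List.finRange_succ, List.filter_map, List.map_map] <;> rfl

theorem length_received_le {N : ℕ} (x d e : Fin N → Bool) : (received x d e).length ≤ N := by
  rw [received, List.length_map]
  exact (List.length_filter_le _ _).trans (by simp)

/-- Links the sum over noise patterns to the recursion, by splitting off the noise acting on the
first bit. -/
theorem sum_noise_eq_expect (pd pe : ℝ) {N : ℕ} (x : Fin N → Bool) (F : List Bool → ℝ) :
    ∑ d : Fin N → Bool, ∑ e : Fin N → Bool,
      (∏ i, bern pd (d i)) * (∏ i, bern pe (e i)) * F (received x d e) =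
      expect pd pe (List.ofFn x) F := by
  induction N generalizing F with
  | zero => simp [received, expect]
  | succ N ih =>
    obtain ⟨b, x, rfl⟩ : ∃ b x', x = Fin.cons b x' := ⟨x 0, Fin.tail x, by simp⟩
    simp only [sum_fin_succ_arrow, Fin.prod_univ_succ, Fin.cons_zero, Fin.cons_succ,
      received_cons, List.ofFn_succ, expect, ← ih]
    simp only [Fintype.sum_bool, bern, if_true, Bool.false_eq_true, if_false, Bool.xor_true,
      Bool.xor_false, Finset.mul_sum, ← Finset.sum_add_distrib]
    refine Finset.sum_congr rfl fun d _ => Finset.sum_congr rfl fun e _ => ?_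
    ring

theorem transition_eq_law (pd pe : ℝ) {N : ℕ} (x : Fin N → Bool) (y : List Bool) :
    transition pd pe x y = law pd pe (List.ofFn x) y := by
  rw [law, ← sum_noise_eq_expect, transition]
  simp only [mul_ite, mul_one, mul_zero]

theorem sum_law_mul (pd pe : ℝ) (x : List Bool) (F : List Bool → ℝ) :
    ∑ y ∈ outputs x.length, law pd pe x y * F y = expect pd pe x F := by
  have key : ∀ {N : ℕ} (x : Fin N → Bool),
      ∑ y ∈ outputs N, transition pd pe x y * F y = expect pd pe (List.ofFn x) F := by
    intro N x
    rw [← sum_noise_eq_expect]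
    simp only [transition, Finset.sum_mul]
    rw [Finset.sum_comm]
    refine Finset.sum_congr rfl fun d _ => ?_
    rw [Finset.sum_comm]
    refine Finset.sum_congr rfl fun e _ => ?_
    simp only [ite_mul, zero_mul]
    rw [Finset.sum_ite_eq, if_pos (mem_outputs.2 (length_received_le x d e))]
  simpa [transition_eq_law] using key x.get

theorem sum_law (pd pe : ℝ) (x : List Bool) : ∑ y ∈ outputs x.length, law pd pe x y = 1 := by
  simpa [expect_const] using sum_law_mul pd pe x fun _ => 1

/-- The law of the output of a concatenation is the convolution of the laws of the outputs. -/
theorem law_append (pd pe : ℝ) (u v y : List Bool) :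
    law pd pe (u ++ v) y =
      ∑ p ∈ outputs u.length ×ˢ outputs v.length with p.1 ++ p.2 = y,
        law pd pe u p.1 * law pd pe v p.2 := by
  rw [law, expect_append, ← sum_law_mul, Finset.sum_filter, Finset.sum_product]
  refine Finset.sum_congr rfl fun y1 _ => ?_
  rw [← sum_law_mul, Finset.mul_sum]
  refine Finset.sum_congr rfl fun y2 _ => ?_
  split_ifs <;> simp

theorem append_mem_outputs {N M : ℕ} {p : List Bool × List Bool}
    (hp : p ∈ outputs N ×ˢ outputs M) : p.1 ++ p.2 ∈ outputs (N + M) := by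
  simp only [Finset.mem_product, mem_outputs] at hp
  simp only [mem_outputs, List.length_append]
  omega

theorem sum_entropyTerm_law_mul_law (pd pe : ℝ) (u v : List Bool) :
    ∑ p ∈ outputs u.length ×ˢ outputs v.length, entropyTerm (law pd pe u p.1 * law pd pe v p.2) =
      lawEntropy pd pe u + lawEntropy pd pe v := by
  simp only [entropyTerm_mul, Finset.sum_add_distrib, Finset.sum_product, ← Finset.sum_mul,
    ← Finset.mul_sum, sum_law, one_mul, lawEntropy]

/-- The output entropy is subadditive under concatenation of the input. -/
theorem lawEntropy_append_le {pd pe : ℝ} (hpd : pd ∈ Set.Icc (0 : ℝ) 1)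
    (hpe : pe ∈ Set.Icc (0 : ℝ) 1) (u v : List Bool) :
    lawEntropy pd pe (u ++ v) ≤ lawEntropy pd pe u + lawEntropy pd pe v := by
  rw [← sum_entropyTerm_law_mul_law, lawEntropy, List.length_append,
    ← Finset.sum_fiberwise_of_maps_to (fun p hp => append_mem_outputs hp)]
  refine Finset.sum_le_sum fun y _ => ?_
  rw [law_append]
  exact entropyTerm_sum_le _ _ fun p _ =>
    mul_nonneg (law_nonneg hpd hpe _ _) (law_nonneg hpd hpe _ _)

/-! ### Subadditivity of the maximal mutual information -/

theorem mutualInfo_eq (pd pe : ℝ) {N : ℕ} (P : (Fin N → Bool) → ℝ) :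
    mutualInfo pd pe P =
      ∑ y ∈ outputs N, entropyTerm (∑ x, P x * law pd pe (List.ofFn x) y)
        - ∑ x, P x * lawEntropy pd pe (List.ofFn x) := by
  simp only [mutualInfo, outputEntropy, condEntropy, outputProb, transition_eq_law, lawEntropy,
    List.length_ofFn]

theorem mutualInfo_le_maxMutualInfo (pd pe : ℝ) {N : ℕ} {P : (Fin N → Bool) → ℝ}
    (hP : P ∈ stdSimplex ℝ (Fin N → Bool)) : mutualInfo pd pe P ≤ maxMutualInfo pd pe N :=
  (isGreatest_maxMutualInfo pd pe N).2 ⟨P, hP, rfl⟩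

theorem maxMutualInfo_nonneg (pd pe : ℝ) (N : ℕ) : 0 ≤ maxMutualInfo pd pe N := by
  refine le_trans (le_of_eq ?_)
    (mutualInfo_le_maxMutualInfo pd pe (single_mem_stdSimplex ℝ (fun _ : Fin N => false)))
  simp [mutualInfo_eq, Pi.single_apply, lawEntropy]

theorem sum_law_ofFn (pd pe : ℝ) {N : ℕ} (x : Fin N → Bool) :
    ∑ y ∈ outputs N, law pd pe (List.ofFn x) y = 1 := by
  simpa using sum_law pd pe (List.ofFn x)

theorem subadditive_maxMutualInfo {pd pe : ℝ} (hpd : pd ∈ Set.Icc (0 : ℝ) 1)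
    (hpe : pe ∈ Set.Icc (0 : ℝ) 1) : Subadditive (maxMutualInfo pd pe) := by
  intro N M
  obtain ⟨P, ⟨hP0, hP1⟩, hP⟩ := (isGreatest_maxMutualInfo pd pe (N + M)).1
  rw [← hP, mutualInfo_eq]
  have esum : ∀ f : (Fin (N + M) → Bool) → ℝ,
      ∑ x, f x = ∑ p : (Fin N → Bool) × (Fin M → Bool), f (Fin.append p.1 p.2) := fun f =>
    (Fintype.sum_equiv (Fin.appendEquiv N M) _ _ fun _ => rfl).symm
  simp only [esum, List.ofFn_fin_append]
  rw [esum] at hP1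
  set R : (Fin N → Bool) × (Fin M → Bool) → ℝ := fun p => P (Fin.append p.1 p.2) with hR
  have hR0 : ∀ p, 0 ≤ R p := fun p => hP0 _
  change ∑ p, R p = 1 at hP1
  change ∑ y ∈ outputs (N + M), entropyTerm (∑ p, R p * _) - ∑ p, R p * _ ≤ _
  -- The true output is a function of the pair of outputs of the two halves, so it carries no more
  -- information than the pair.
  have dp := mutualInfo_map_le Finset.univ (outputs N ×ˢ outputs M) (outputs (N + M))
    (fun p => p.1 ++ p.2) (fun p hp => append_mem_outputs hp) R
    (fun x p => law pd pe (List.ofFn x.1) p.1 * law pd pe (List.ofFn x.2) p.2)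
    (fun p _ => hR0 p)
    (fun x p _ => mul_nonneg (law_nonneg hpd hpe _ _) (law_nonneg hpd hpe _ _))
  have e1 : ∀ (x : (Fin N → Bool) × (Fin M → Bool)) (y : List Bool),
      ∑ p ∈ outputs N ×ˢ outputs M with p.1 ++ p.2 = y,
        law pd pe (List.ofFn x.1) p.1 * law pd pe (List.ofFn x.2) p.2 =
      law pd pe (List.ofFn x.1 ++ List.ofFn x.2) y := by
    intro x y
    rw [law_append, List.length_ofFn, List.length_ofFn]
  have e2 : ∀ (x : (Fin N → Bool) × (Fin M → Bool)),
      ∑ p ∈ outputs N ×ˢ outputs M,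
        entropyTerm (law pd pe (List.ofFn x.1) p.1 * law pd pe (List.ofFn x.2) p.2) =
      lawEntropy pd pe (List.ofFn x.1) + lawEntropy pd pe (List.ofFn x.2) := by
    intro x
    rw [← sum_entropyTerm_law_mul_law, List.length_ofFn, List.length_ofFn]
  have e3 : ∀ (x : (Fin N → Bool) × (Fin M → Bool)),
      ∑ y ∈ outputs (N + M), entropyTerm (law pd pe (List.ofFn x.1 ++ List.ofFn x.2) y) =
      lawEntropy pd pe (List.ofFn x.1 ++ List.ofFn x.2) := by
    intro x
    rw [lawEntropy, List.length_append, List.length_ofFn, List.length_ofFn]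
  simp only [e1, e2, e3] at dp
  refine dp.trans ?_
  set P1 : (Fin N → Bool) → ℝ := fun x => ∑ z, R (x, z) with hP1def
  set P2 : (Fin M → Bool) → ℝ := fun z => ∑ x, R (x, z) with hP2def
  have m1 : P1 ∈ stdSimplex ℝ (Fin N → Bool) :=
    ⟨fun x => Finset.sum_nonneg fun z _ => hR0 _, by rw [← hP1, Fintype.sum_prod_type]⟩
  have m2 : P2 ∈ stdSimplex ℝ (Fin M → Bool) :=
    ⟨fun x => Finset.sum_nonneg fun z _ => hR0 _, by rw [← hP1, Fintype.sum_prod_type_right]⟩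
  have b1 := mutualInfo_le_maxMutualInfo pd pe m1
  have b2 := mutualInfo_le_maxMutualInfo pd pe m2
  rw [mutualInfo_eq] at b1 b2
  have f1 : ∀ φ : (Fin N → Bool) → ℝ, ∑ p, R p * φ p.1 = ∑ x, P1 x * φ x := fun φ => by
    simp only [Fintype.sum_prod_type, P1, Finset.sum_mul]
  have f2 : ∀ φ : (Fin M → Bool) → ℝ, ∑ p, R p * φ p.2 = ∑ x, P2 x * φ x := fun φ => by
    simp only [Fintype.sum_prod_type_right, P2, Finset.sum_mul]
  -- Given the input, the halves are independent, so conditional entropy splits exactly; the output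
  -- entropy only needs `≤`.
  have hcond : ∑ p, R p * (lawEntropy pd pe (List.ofFn p.1) + lawEntropy pd pe (List.ofFn p.2)) =
      ∑ x, P1 x * lawEntropy pd pe (List.ofFn x) + ∑ x, P2 x * lawEntropy pd pe (List.ofFn x) := by
    rw [← f1, ← f2]
    simp only [mul_add, Finset.sum_add_distrib]
  have r1 : ∀ y, ∑ z ∈ outputs M, ∑ p, R p * (law pd pe (List.ofFn p.1) y *
      law pd pe (List.ofFn p.2) z) = ∑ x, P1 x * law pd pe (List.ofFn x) y := by
    intro y
    rw [Finset.sum_comm, ← f1 fun x => law pd pe (List.ofFn x) y]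
    simp only [← Finset.mul_sum, sum_law_ofFn, mul_one]
  have r2 : ∀ z, ∑ y ∈ outputs N, ∑ p, R p * (law pd pe (List.ofFn p.1) y *
      law pd pe (List.ofFn p.2) z) = ∑ x, P2 x * law pd pe (List.ofFn x) z := by
    intro z
    rw [Finset.sum_comm, ← f2 fun x => law pd pe (List.ofFn x) z]
    simp only [← Finset.mul_sum, ← Finset.sum_mul, sum_law_ofFn, one_mul]
  have hjoint := sum_entropyTerm_prod_le (outputs N) (outputs M)
    (fun y z => ∑ p, R p * (law pd pe (List.ofFn p.1) y * law pd pe (List.ofFn p.2) z))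
    (fun y _ z _ => Finset.sum_nonneg fun p _ => mul_nonneg (hR0 p)
      (mul_nonneg (law_nonneg hpd hpe _ _) (law_nonneg hpd hpe _ _)))
    (by
      simp only [r1]
      rw [Finset.sum_comm]
      simp only [← Finset.mul_sum, sum_law_ofFn, mul_one]
      exact m1.2)
  simp only [r1, r2] at hjoint
  rw [hcond, Finset.sum_product]
  linarith

/-! ### Uniformly distributed inputs -/

/-- The average of `F` over all binary lists of length `N`. -/
noncomputable def avg (N : ℕ) (F : List Bool → ℝ) : ℝ :=
  (∑ x : Fin N → Bool, F (List.ofFn x)) / 2 ^ N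

section avg

theorem avg_zero (F : List Bool → ℝ) : avg 0 F = F [] := by
  simp [avg]

theorem avg_succ (N : ℕ) (F : List Bool → ℝ) :
    avg (N + 1) F = (avg N (fun x => F (true :: x)) + avg N fun x => F (false :: x)) / 2 := by
  simp only [avg, sum_fin_succ_arrow, Fintype.sum_bool, List.ofFn_succ, Fin.cons_zero,
    Fin.cons_succ, pow_succ]
  ring

theorem avg_add (N : ℕ) (F G : List Bool → ℝ) :
    avg N (fun x => F x + G x) = avg N F + avg N G := by
  simp only [avg, Finset.sum_add_distrib, add_div]

theorem avg_const_mul (N : ℕ) (a : ℝ) (F : List Bool → ℝ) :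
    avg N (fun x => a * F x) = a * avg N F := by
  simp only [avg, ← Finset.mul_sum, mul_div_assoc]

theorem avg_const (N : ℕ) (a : ℝ) : avg N (fun _ => a) = a := by
  simp [avg]

theorem avg_mono {N : ℕ} {F G : List Bool → ℝ} (h : ∀ x, x.length = N → F x ≤ G x) :
    avg N F ≤ avg N G :=
  div_le_div_of_nonneg_right (Finset.sum_le_sum fun x _ => h _ (by simp)) (by positivity)

theorem avg_append (N M : ℕ) (F : List Bool → ℝ) :
    avg (N + M) F = avg N fun u => avg M fun v => F (u ++ v) := by
  induction N generalizing F with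
  | zero => simp [avg_zero]
  | succ N ih => simp only [Nat.succ_add, avg_succ, ih, List.cons_append]

end avg

section uniform

variable {pd pe : ℝ}

theorem avg_law_le (hpd : pd ∈ Set.Icc (0 : ℝ) 1) (N : ℕ) (y : List Bool) :
    avg N (fun x => law pd pe x y) ≤ (1 / 2) ^ y.length := by
  obtain ⟨h1, h2⟩ := hpd
  induction N generalizing y with
  | zero =>
    rw [avg_zero, law_nil]
    split_ifs with h
    · simp [h]
    · positivity
  | succ N ih =>
    rw [avg_succ]
    cases y with
    | nil =>
      have := ih []
      simp only [law_cons_nil, avg_const_mul, List.length_nil, pow_zero] at this ⊢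
      nlinarith
    | cons c y =>
      have a1 := mul_le_mul_of_nonneg_left (ih (c :: y)) h1
      have a2 := mul_le_mul_of_nonneg_left (ih y) (sub_nonneg.2 h2)
      simp only [law_cons_cons, avg_add, avg_const_mul, List.length_cons, pow_succ] at a1 a2 ⊢
      -- Averaged over a fair input bit, an undeleted bit is received as `c` with probability `1/2`,
      -- whatever `pe` is.
      have : bern pe (xor true c) + bern pe (xor false c) = 1 := by cases c <;> simp [bern]
      have e : ∀ A B s t : ℝ, (pd * A + (1 - pd) * (s * B) + (pd * A + (1 - pd) * (t * B))) / 2 =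
        pd * A + (1 - pd) * B * (s + t) / 2 := by intros; ring
      rw [e, this]
      linarith

theorem avg_nonneg {N : ℕ} {F : List Bool → ℝ} (h : ∀ x, 0 ≤ F x) : 0 ≤ avg N F := by
  rw [← avg_const N 0]
  exact avg_mono fun x _ => h x

theorem expect_map_sum (pd pe : ℝ) (g : Bool → ℝ) (x : List Bool) :
    expect pd pe x (fun y => (y.map g).sum) =
      (x.map fun b => (1 - pd) * (pe * g (!b) + (1 - pe) * g b)).sum := by
  induction x with
  | nil => simp [expect]
  | cons b x ih =>
    simp only [expect, List.map_cons, List.sum_cons, expect_add, expect_const, ih]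
    ring

theorem expect_length (pd pe : ℝ) (x : List Bool) :
    expect pd pe x (fun y => (y.length : ℝ)) = (1 - pd) * x.length := by
  simpa [mul_comm] using expect_map_sum pd pe (fun _ => 1) x

/-- A lower bound for the output entropy when the input is uniformly distributed. -/
theorem le_sum_entropyTerm_avg_law (hpd : pd ∈ Set.Icc (0 : ℝ) 1) (hpe : pe ∈ Set.Icc (0 : ℝ) 1)
    (N : ℕ) : (1 - pd) * N ≤ ∑ y ∈ outputs N, entropyTerm (avg N fun x => law pd pe x y) := by
  -- The left side is the mean output length, to be compared termwise with `-log₂ P(y) ≥ |y|`.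
  have e : (1 - pd) * N = ∑ y ∈ outputs N, (avg N fun x => law pd pe x y) * y.length := by
    simp only [avg, div_mul_eq_mul_div, ← Finset.sum_div, Finset.sum_mul]
    rw [Finset.sum_comm]
    have : ∀ x : Fin N → Bool, ∑ y ∈ outputs N, law pd pe (List.ofFn x) y * (y.length : ℝ) =
        (1 - pd) * N := fun x => by
      simpa [expect_length] using sum_law_mul pd pe (List.ofFn x) fun y => (y.length : ℝ)
    simp [this]
  rw [e]
  refine Finset.sum_le_sum fun y _ => ?_
  have h0 : 0 ≤ avg N fun x => law pd pe x y := avg_nonneg fun x => law_nonneg hpd hpe x y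
  rcases h0.eq_or_lt with h | h
  · simp [← h, entropyTerm]
  · rw [entropyTerm, ← mul_neg]
    refine mul_le_mul_of_nonneg_left ?_ h0
    have := Real.logb_le_logb_of_le one_lt_two h (avg_law_le (pe := pe) hpd N y)
    rw [Real.logb_pow, one_div, Real.logb_inv, Real.logb_self_eq_one one_lt_two] at this
    linarith

theorem le_maxMutualInfo (hpd : pd ∈ Set.Icc (0 : ℝ) 1) (hpe : pe ∈ Set.Icc (0 : ℝ) 1) (N : ℕ) :
    (1 - pd) * N - avg N (lawEntropy pd pe) ≤ maxMutualInfo pd pe N := by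
  have hP : (fun _ => 1 / 2 ^ N : (Fin N → Bool) → ℝ) ∈ stdSimplex ℝ (Fin N → Bool) :=
    ⟨fun _ => by positivity, by simp⟩
  refine le_trans ?_ (mutualInfo_le_maxMutualInfo pd pe hP)
  rw [mutualInfo_eq]
  have := le_sum_entropyTerm_avg_law hpd hpe N
  simp only [avg, ← Finset.sum_div, one_div_mul_eq_div] at this ⊢
  linarith

theorem subadditive_avg_lawEntropy (hpd : pd ∈ Set.Icc (0 : ℝ) 1) (hpe : pe ∈ Set.Icc (0 : ℝ) 1) :
    Subadditive fun N => avg N (lawEntropy pd pe) := by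
  intro N M
  dsimp only
  rw [avg_append]
  refine (avg_mono fun u _ => avg_mono fun v _ => lawEntropy_append_le hpd hpe u v).trans
    (le_of_eq ?_)
  simp only [avg_add, avg_const]

theorem law_le_one (hpd : pd ∈ Set.Icc (0 : ℝ) 1) (hpe : pe ∈ Set.Icc (0 : ℝ) 1)
    {x y : List Bool} (hy : y ∈ outputs x.length) : law pd pe x y ≤ 1 := by
  rw [← sum_law pd pe x]
  exact Finset.single_le_sum (fun y _ => law_nonneg hpd hpe x y) hy

theorem lawEntropy_nonneg (hpd : pd ∈ Set.Icc (0 : ℝ) 1) (hpe : pe ∈ Set.Icc (0 : ℝ) 1)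
    (x : List Bool) : 0 ≤ lawEntropy pd pe x := by
  refine Finset.sum_nonneg fun y hy => ?_
  rw [entropyTerm, ← mul_neg]
  have h0 := law_nonneg hpd hpe x y
  exact mul_nonneg h0
    (neg_nonneg.2 (Real.logb_nonpos one_lt_two h0 (law_le_one hpd hpe hy)))

end uniform

/-! ### Runs of equal bits -/

section runs

/-- The mean of `log₂ (r.choose D)` for the number `D` of deletions in a run of length `r`. -/
noncomputable def meanLogChoose (p : ℝ) (r : ℕ) : ℝ :=
  ∑ j ∈ Finset.range (r + 1), (r.choose j : ℝ) * p ^ j * (1 - p) ^ (r - j) *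
    Real.logb 2 (r.choose j)

/-- Within a run the position of a deletion is invisible, so all deletion patterns with the same
count merge; this produces the binomial coefficient. -/
theorem law_replicate (pd pe : ℝ) (r : ℕ) (b : Bool) (y : List Bool) :
    law pd pe (List.replicate r b) y =
      (r.choose y.length : ℝ) * pd ^ (r - y.length) * (1 - pd) ^ y.length *
        (y.map fun c => bern pe (xor b c)).prod := by
  induction r generalizing y with
  | zero => cases y <;> simp [law_nil]
  | succ r ih =>
    rw [List.replicate_succ]
    cases y with
    | nil =>
      rw [law_cons_nil, ih]
      simp [pow_succ']
    | cons c y =>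
      rw [law_cons_cons, ih, ih]
      simp only [List.length_cons, List.map_cons, List.prod_cons, Nat.choose_succ_succ',
        Nat.cast_add, Nat.add_sub_add_right, pow_succ (1 - pd)]
      rcases le_or_gt (y.length + 1) r with h | h
      · obtain ⟨k, rfl⟩ := Nat.exists_eq_add_of_le h
        rw [show y.length + 1 + k - (y.length + 1) = k by omega,
          show y.length + 1 + k - y.length = k + 1 by omega]
        ring
      · rw [Nat.choose_eq_zero_of_lt h]
        simp only [Nat.cast_zero]
        ring

theorem expect_replicate_length (pd pe : ℝ) (r : ℕ) (b : Bool) (φ : ℕ → ℝ) :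
    expect pd pe (List.replicate r b) (fun y => φ y.length) =
      ∑ j ∈ Finset.range (r + 1), (r.choose j : ℝ) * ((1 - pd) ^ j * pd ^ (r - j) * φ j) := by
  induction r generalizing φ with
  | zero => simp [expect]
  | succ r ih =>
    rw [List.replicate_succ, expect]
    simp only [List.length_cons, ih, ih fun k => φ (k + 1)]
    rw [Finset.sum_choose_succ_mul fun i k => (1 - pd) ^ i * pd ^ k * φ i, ← add_mul,
      add_sub_cancel, one_mul, Finset.mul_sum, Finset.mul_sum]
    congr 1 <;> refine Finset.sum_congr rfl fun j hj => ?_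
    · rw [Nat.succ_sub (Nat.lt_succ_iff.1 (Finset.mem_range.1 hj)), pow_succ]
      ring
    · ring

theorem expect_replicate_logb_choose (pd pe : ℝ) (r : ℕ) (b : Bool) :
    expect pd pe (List.replicate r b) (fun y => Real.logb 2 (r.choose y.length)) =
      meanLogChoose pd r := by
  -- The expectation counts received bits and `meanLogChoose` counts deletions; reflecting the sum
  -- exchanges them.
  rw [expect_replicate_length pd pe r b fun k => Real.logb 2 (r.choose k),
    ← Finset.sum_range_reflect, meanLogChoose]
  refine Finset.sum_congr rfl fun j hj => ?_
  have hj' : j ≤ r := Nat.lt_succ_iff.1 (Finset.mem_range.1 hj)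
  rw [show r + 1 - 1 - j = r - j by omega, Nat.choose_symm hj', Nat.sub_sub_self hj']
  ring

/-- The output entropy of a run. -/
theorem lawEntropy_replicate (pd pe : ℝ) (r : ℕ) (b : Bool) :
    lawEntropy pd pe (List.replicate r b) =
      r * (Hb pd + (1 - pd) * Hb pe) - meanLogChoose pd r := by
  -- Contribution of one received bit to `-log₂ P(y)`, once the `r - |y|` deletions are written as
  -- `r` minus the received bits.
  set g : Bool → ℝ := fun c =>
    Real.logb 2 pd - Real.logb 2 (1 - pd) - Real.logb 2 (bern pe (xor b c)) with hg
  have key : ∀ y, entropyTerm (law pd pe (List.replicate r b) y) =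
      law pd pe (List.replicate r b) y *
        (-1 * Real.logb 2 (r.choose y.length) + (-(r * Real.logb 2 pd) + (y.map g).sum)) := by
    intro y
    rcases eq_or_ne (law pd pe (List.replicate r b) y) 0 with h | h
    · simp [h, entropyTerm]
    rw [entropyTerm, ← mul_neg]
    congr 1
    rw [law_replicate] at h ⊢
    have h4 := right_ne_zero_of_mul h
    have h' := left_ne_zero_of_mul h
    have h3 := right_ne_zero_of_mul h'
    have h'' := left_ne_zero_of_mul h'
    have h2 := right_ne_zero_of_mul h''
    have h1 := left_ne_zero_of_mul h''
    rw [Real.logb_mul h' h4, Real.logb_mul h'' h3, Real.logb_mul h1 h2, Real.logb_pow,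
      Real.logb_pow]
    have hle : y.length ≤ r := by
      by_contra hlt
      exact h1 (by rw [Nat.choose_eq_zero_of_lt (not_le.1 hlt), Nat.cast_zero])
    have hsum : ∀ z : List Bool, (z.map fun c => bern pe (xor b c)).prod ≠ 0 →
        (z.map g).sum = z.length * (Real.logb 2 pd - Real.logb 2 (1 - pd))
          - Real.logb 2 (z.map fun c => bern pe (xor b c)).prod := by
      intro z
      induction z with
      | nil => simp
      | cons c z ih =>
        intro hz
        simp only [List.map_cons, List.prod_cons, List.sum_cons, List.length_cons] at hz ⊢
        rw [ih (right_ne_zero_of_mul hz),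
          Real.logb_mul (left_ne_zero_of_mul hz) (right_ne_zero_of_mul hz), hg]
        push_cast
        ring
    rw [hsum y h4, Nat.cast_sub hle]
    ring
  rw [lawEntropy, Finset.sum_congr rfl fun y _ => key y, sum_law_mul, expect_add,
    expect_const_mul, expect_add, expect_const, expect_map_sum, expect_replicate_logb_choose,
    List.map_replicate, List.sum_replicate, nsmul_eq_mul]
  have e : pe * g (!b) + (1 - pe) * g b =
      Real.logb 2 pd - Real.logb 2 (1 - pd) + Hb pe := by
    cases b <;> simp [hg, bern, Hb] <;> ring
  rw [e]
  simp only [Hb]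
  ring

/-- The sum of `ψ` over the lengths of the runs of `replicate r b ++ x`, where `0 < r`. -/
noncomputable def runSum (ψ : ℕ → ℝ) : Bool → ℕ → List Bool → ℝ
  | _, r, [] => ψ r
  | b, r, c :: x => if c = b then runSum ψ b (r + 1) x else ψ r + runSum ψ c 1 x

theorem lawEntropy_replicate_append_le {pd pe : ℝ} (hpd : pd ∈ Set.Icc (0 : ℝ) 1)
    (hpe : pe ∈ Set.Icc (0 : ℝ) 1) (b : Bool) (r : ℕ) (x : List Bool) :
    lawEntropy pd pe (List.replicate r b ++ x) ≤
      (r + x.length) * (Hb pd + (1 - pd) * Hb pe) - runSum (meanLogChoose pd) b r x := by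
  induction x generalizing b r with
  | nil => simp [lawEntropy_replicate, runSum]
  | cons c x ih =>
    rw [runSum]
    split_ifs with h
    · subst h
      have := ih c (r + 1)
      rw [List.replicate_succ', List.append_assoc, List.singleton_append] at this
      refine this.trans (le_of_eq ?_)
      push_cast [List.length_cons]
      ring
    · have h1 := lawEntropy_append_le hpd hpe (List.replicate r b) (c :: x)
      have h2 := ih c 1
      rw [lawEntropy_replicate] at h1
      rw [List.replicate_one, List.singleton_append] at h2
      push_cast [List.length_cons] at h2 ⊢
      linarith

/-- The current run gains exactly `i < m` bits with probability `2^{-(i+1)}`, or all `m` with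
probability `2^{-m}`. A later run of length `l + 1` has `m - l - 1` interior places of probability
`2^{-(l+2)}` and a final one of twice that, whence the factor `m - l + 1`. -/
theorem avg_runSum (ψ : ℕ → ℝ) (m : ℕ) (b : Bool) (r : ℕ) :
    avg m (runSum ψ b r) =
      ∑ i ∈ Finset.range m, (1 / 2 : ℝ) ^ (i + 1) * ψ (r + i) + (1 / 2) ^ m * ψ (r + m)
        + ∑ l ∈ Finset.range m, (1 / 2 : ℝ) ^ (l + 2) * ((m : ℝ) - l + 1) * ψ (l + 1) := by
  induction m generalizing b r with
  | zero => simp [avg_zero, runSum]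
  | succ m ih =>
    have h : avg (m + 1) (runSum ψ b r) =
        (avg m (runSum ψ b (r + 1)) + (ψ r + avg m (runSum ψ (!b) 1))) / 2 := by
      rw [avg_succ]
      cases b <;> simp [runSum, avg_add, avg_const, add_comm]
    rw [h, ih, ih, Finset.sum_range_succ', Finset.sum_range_succ (fun l =>
      (1 / 2 : ℝ) ^ (l + 2) * (((m + 1 : ℕ) : ℝ) - l + 1) * ψ (l + 1))]
    have e1 : ∑ l ∈ Finset.range m, (1 / 2 : ℝ) ^ (l + 2) * (((m + 1 : ℕ) : ℝ) - l + 1) * ψ (l + 1)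
        = ∑ l ∈ Finset.range m, (1 / 2 : ℝ) ^ (l + 2) * ((m : ℝ) - l + 1) * ψ (l + 1)
          + (∑ l ∈ Finset.range m, (1 / 2 : ℝ) ^ (l + 1) * ψ (1 + l)) / 2 := by
      rw [Finset.sum_div, ← Finset.sum_add_distrib]
      refine Finset.sum_congr rfl fun l _ => ?_
      rw [add_comm 1 l]
      push_cast
      ring
    have e2 : ∑ i ∈ Finset.range m, (1 / 2 : ℝ) ^ (i + 1 + 1) * ψ (r + (i + 1)) =
        (∑ i ∈ Finset.range m, (1 / 2 : ℝ) ^ (i + 1) * ψ (r + 1 + i)) / 2 := by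
      rw [Finset.sum_div]
      refine Finset.sum_congr rfl fun l _ => ?_
      rw [add_assoc r 1 l, add_comm 1 l]
      ring
    rw [e1, e2, add_comm 1 m, add_assoc r 1 m, add_comm 1 m, zero_add, pow_one,
      add_zero]
    generalize ∑ i ∈ Finset.range m, (1 / 2 : ℝ) ^ (i + 1) * ψ (r + 1 + i) = A
    generalize ∑ i ∈ Finset.range m, (1 / 2 : ℝ) ^ (i + 1) * ψ (1 + i) = B
    generalize ∑ l ∈ Finset.range m, (1 / 2 : ℝ) ^ (l + 2) * ((m : ℝ) - l + 1) * ψ (l + 1) = C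
    push_cast
    ring

theorem avg_lawEntropy_le {pd pe : ℝ} (hpd : pd ∈ Set.Icc (0 : ℝ) 1)
    (hpe : pe ∈ Set.Icc (0 : ℝ) 1) (m : ℕ) :
    avg (m + 1) (lawEntropy pd pe) ≤ ((m : ℝ) + 1) * (Hb pd + (1 - pd) * Hb pe)
      - (∑ l ∈ Finset.range m,
          (1 / 2 : ℝ) ^ (l + 2) * ((m : ℝ) - l + 3) * meanLogChoose pd (l + 1)
        + (1 / 2) ^ m * meanLogChoose pd (m + 1)) := by
  have h : ∀ c, avg m (fun x => lawEntropy pd pe (c :: x)) ≤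
      ((m : ℝ) + 1) * (Hb pd + (1 - pd) * Hb pe)
        + -1 * avg m (runSum (meanLogChoose pd) c 1) := by
    intro c
    rw [← avg_const m (((m : ℝ) + 1) * (Hb pd + (1 - pd) * Hb pe)), ← avg_const_mul, ← avg_add]
    refine avg_mono fun x hx => ?_
    have := lawEntropy_replicate_append_le hpd hpe c 1 x
    rw [List.replicate_one, List.singleton_append, hx] at this
    push_cast at this
    linarith
  have ht := h true
  have hf := h false
  rw [avg_runSum] at ht hf
  -- The initial run contributes `2^{-(l+1)} = 2 * 2^{-(l+2)}`, which raises the factor `m - l + 1`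
  -- to `m - l + 3`.
  have e : ∑ l ∈ Finset.range m,
        (1 / 2 : ℝ) ^ (l + 2) * ((m : ℝ) - l + 3) * meanLogChoose pd (l + 1) =
      ∑ l ∈ Finset.range m, (1 / 2 : ℝ) ^ (l + 1) * meanLogChoose pd (1 + l) +
      ∑ l ∈ Finset.range m,
        (1 / 2 : ℝ) ^ (l + 2) * ((m : ℝ) - l + 1) * meanLogChoose pd (l + 1) := by
    rw [← Finset.sum_add_distrib]
    refine Finset.sum_congr rfl fun l _ => ?_
    rw [add_comm 1 l]
    ring
  rw [avg_succ, e, add_comm m 1]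
  linarith

/-- Conditioning on the total number of deletions in a block of length `n`. -/
theorem sum_choose_mul_choose_eq_meanLogChoose (p : ℝ) {l n : ℕ} (hln : l ≤ n) :
    ∑ j ∈ Finset.Icc 1 n, (∑ i ∈ Finset.Icc 1 j,
      (l.choose i : ℝ) * ((n - l).choose (j - i) : ℝ) * Real.logb 2 (l.choose i)) *
        (p ^ j * (1 - p) ^ (n - j)) = meanLogChoose p l := by
  -- The sums may start at 0: for `j = 0` the inner sum is empty, and for `i = 0` the logarithm is
  -- `log 1`.
  have icc : ∀ (k : ℕ) (f : ℕ → ℝ), f 0 = 0 →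
      ∑ i ∈ Finset.Icc 1 k, f i = ∑ i ∈ Finset.range (k + 1), f i := by
    intro k f hf
    rw [Finset.sum_range_succ', hf, add_zero, Finset.range_eq_Ico, Finset.sum_Ico_add' f 0 k 1]
    rfl
  set f : ℕ → ℕ → ℝ := fun i k => (l.choose i : ℝ) * ((n - l).choose k : ℝ) *
    Real.logb 2 (l.choose i) * (p ^ (i + k) * (1 - p) ^ (n - (i + k))) with hf
  have h1 : ∑ j ∈ Finset.Icc 1 n, (∑ i ∈ Finset.Icc 1 j,
      (l.choose i : ℝ) * ((n - l).choose (j - i) : ℝ) * Real.logb 2 (l.choose i)) *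
        (p ^ j * (1 - p) ^ (n - j)) =
      ∑ j ∈ Finset.range (n + 1), ∑ i ∈ Finset.range (j + 1), f i (j - i) := by
    rw [icc _ _ (by simp)]
    refine Finset.sum_congr rfl fun j _ => ?_
    rw [icc _ _ (by simp), Finset.sum_mul]
    refine Finset.sum_congr rfl fun i hi => ?_
    rw [hf]
    simp only [Nat.add_sub_cancel' (Nat.lt_succ_iff.1 (Finset.mem_range.1 hi))]
  -- Now `i` deletions fall inside the run and `k` outside; the sum over `k` is 1 by the binomial
  -- theorem.
  rw [h1, Finset.sum_range_diag_flip, meanLogChoose,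
    ← Finset.sum_subset (Finset.range_subset_range.2 (Nat.succ_le_succ hln))]
  · refine Finset.sum_congr rfl fun i hi => ?_
    have hi' : i ≤ l := Nat.lt_succ_iff.1 (Finset.mem_range.1 hi)
    rw [← Finset.sum_subset (Finset.range_subset_range.2 (show n - l + 1 ≤ n + 1 - i by omega))]
    · have hb := add_pow p (1 - p) (n - l)
      rw [add_sub_cancel, one_pow] at hb
      rw [← mul_one ((l.choose i : ℝ) * p ^ i * (1 - p) ^ (l - i) * Real.logb 2 (l.choose i))]
      refine Eq.trans ?_ (congrArg _ hb.symm)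
      rw [Finset.mul_sum]
      refine Finset.sum_congr rfl fun k hk => ?_
      have hk' : k ≤ n - l := Nat.lt_succ_iff.1 (Finset.mem_range.1 hk)
      simp only [hf]
      rw [show n - (i + k) = (l - i) + (n - l - k) by omega, pow_add, pow_add]
      ring
    · intro k _ hk
      rw [Finset.mem_range, not_lt] at hk
      simp [hf, Nat.choose_eq_zero_of_lt (show n - l < k by omega)]
  · intro i _ hi
    rw [Finset.mem_range, not_lt] at hi
    refine Finset.sum_eq_zero fun k _ => ?_
    simp [hf, Nat.choose_eq_zero_of_lt (show l < i by omega)]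

/-- `W j n` is the mean, given `j` deletions in a uniform block, of the sum over its runs of `log₂`
of run length choose deletions. Averaging over `j` removes the conditioning; `j = 0` contributes
nothing. -/
theorem sum_W_mul (p : ℝ) (m : ℕ) :
    ∑ j ∈ Finset.Icc 1 (m + 1),
        W j (m + 1) * ((m + 1).choose j : ℝ) * p ^ j * (1 - p) ^ (m + 1 - j) =
      ∑ l ∈ Finset.range m,
          (1 / 2 : ℝ) ^ (l + 2) * ((m : ℝ) - l + 3) * meanLogChoose p (l + 1)
        + (1 / 2) ^ m * meanLogChoose p (m + 1) := by
  set n := m + 1 with hn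
  have h1 : ∀ j ∈ Finset.Icc 1 n, W j n * (n.choose j : ℝ) * p ^ j * (1 - p) ^ (n - j) =
      ∑ l ∈ Finset.Icc 1 (n - 1), (2 : ℝ) ^ (-(l : ℤ) - 1) * ((n : ℝ) - l + 3) *
        ((∑ i ∈ Finset.Icc 1 j, (l.choose i : ℝ) * ((n - l).choose (j - i) : ℝ) *
          Real.logb 2 (l.choose i)) * (p ^ j * (1 - p) ^ (n - j)))
      + (2 : ℝ) ^ (-(n : ℤ) + 1) * ((n.choose j : ℝ) * p ^ j * (1 - p) ^ (n - j) *
        Real.logb 2 (n.choose j)) := by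
    intro j hj
    have hc : (n.choose j : ℝ) ≠ 0 :=
      Nat.cast_ne_zero.2 (Nat.choose_pos (Finset.mem_Icc.1 hj).2).ne'
    have e : ∀ X S z L P Q : ℝ, X ≠ 0 →
        (1 / X * S + z * L) * X * P * Q = S * (P * Q) + z * (X * P * Q * L) := by
      intros
      field_simp
    rw [W, e _ _ _ _ _ _ hc, Finset.sum_mul]
    simp only [mul_assoc]
  rw [Finset.sum_congr rfl h1, Finset.sum_add_distrib, Finset.sum_comm]
  simp only [← Finset.mul_sum]
  congr 1
  · rw [show n - 1 = m by omega, Finset.range_eq_Ico]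
    rw [show Finset.Icc 1 m = Finset.Ico (0 + 1) (m + 1) from rfl, ← Finset.sum_Ico_add']
    refine Finset.sum_congr rfl fun l hl => ?_
    rw [sum_choose_mul_choose_eq_meanLogChoose p
      (by have := (Finset.mem_Ico.1 hl).2; omega)]
    have e : (2 : ℝ) ^ (-((l + 1 : ℕ) : ℤ) - 1) = (1 / 2) ^ (l + 2) := by
      rw [show -((l + 1 : ℕ) : ℤ) - 1 = -((l + 2 : ℕ) : ℤ) by push_cast; ring, zpow_neg,
        zpow_natCast, one_div, inv_pow]
    rw [e, hn]
    push_cast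
    ring
  · have e : (2 : ℝ) ^ (-(n : ℤ) + 1) = (1 / 2) ^ m := by
      rw [show -(n : ℤ) + 1 = -(m : ℤ) by rw [hn]; push_cast; ring, zpow_neg,
        zpow_natCast, one_div, inv_pow]
    rw [e, meanLogChoose, Finset.sum_range_succ', Finset.range_eq_Ico,
      Finset.sum_Ico_add' (fun j => (n.choose j : ℝ) * p ^ j * (1 - p) ^ (n - j) *
        Real.logb 2 (n.choose j)) 0 n 1]
    simp
    rfl

end runs

/-! ### Passage to the limit -/

theorem tendsto_maxMutualInfo_div {pd pe : ℝ} (hpd : pd ∈ Set.Icc (0 : ℝ) 1)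
    (hpe : pe ∈ Set.Icc (0 : ℝ) 1) :
    Filter.Tendsto (fun N : ℕ => (1 / (N : ℝ)) * maxMutualInfo pd pe N) Filter.atTop
      (nhds (capacity pd pe)) := by
  have h := (subadditive_maxMutualInfo hpd hpe).tendsto_lim
    ⟨0, by rintro _ ⟨N, rfl⟩; exact div_nonneg (maxMutualInfo_nonneg pd pe N) N.cast_nonneg⟩
  have e : (fun N : ℕ => (1 / (N : ℝ)) * maxMutualInfo pd pe N) =
      fun N : ℕ => maxMutualInfo pd pe N / N := funext fun N => one_div_mul_eq_div _ _
  rw [capacity, e, h.limUnder_eq]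
  exact h

theorem le_capacity {pd pe : ℝ} (hpd : pd ∈ Set.Icc (0 : ℝ) 1) (hpe : pe ∈ Set.Icc (0 : ℝ) 1)
    {n : ℕ} (hn : n ≠ 0) : 1 - pd - avg n (lawEntropy pd pe) / n ≤ capacity pd pe := by
  have hs := subadditive_avg_lawEntropy hpd hpe
  have hb : BddBelow (Set.range fun N : ℕ => avg N (lawEntropy pd pe) / N) :=
    ⟨0, by
      rintro _ ⟨N, rfl⟩
      exact div_nonneg (avg_nonneg (lawEntropy_nonneg hpd hpe)) N.cast_nonneg⟩
  -- The limit of a subadditive sequence over `N` is its infimum, hence at most the value at block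
  -- length `n`.
  refine (sub_le_sub_left (hs.lim_le_div hb hn) _).trans ?_
  refine le_of_tendsto_of_tendsto ((hs.tendsto_lim hb).const_sub (1 - pd))
    (tendsto_maxMutualInfo_div hpd hpe) ?_
  filter_upwards [Filter.eventually_gt_atTop 0] with N hN
  have hN' : (0 : ℝ) < N := Nat.cast_pos.2 hN
  have := div_le_div_of_nonneg_right (le_maxMutualInfo hpd hpe N) hN'.le
  rw [sub_div, mul_div_cancel_right₀ _ hN'.ne'] at this
  rwa [one_div_mul_eq_div]

end DelSub

theorem mainTheorem2 (pd pe : ℝ) (hpd : pd ∈ Set.Icc (0 : ℝ) 1) (hpe : pe ∈ Set.Icc (0 : ℝ) 1) :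
    Filter.Tendsto (fun N : ℕ => (1 / (N : ℝ)) * DelSub.maxMutualInfo pd pe N) Filter.atTop
        (nhds (DelSub.capacity pd pe)) ∧
      ∀ n : ℕ, 0 < n →
        DelSub.capacity pd pe ≥
          1 - pd - DelSub.Hb pd
            + (1 / (n : ℝ)) * (∑ j ∈ Finset.Icc 1 n,
                DelSub.W j n * (n.choose j : ℝ) * pd ^ j * (1 - pd) ^ (n - j))
            - (1 - pd) * DelSub.Hb pe := by
  refine ⟨DelSub.tendsto_maxMutualInfo_div hpd hpe, fun n hn => ?_⟩
  obtain ⟨m, rfl⟩ := Nat.exists_eq_succ_of_ne_zero hn.ne'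
  have hm : (0 : ℝ) < (m : ℝ) + 1 := by positivity
  have h1 := DelSub.le_capacity hpd hpe hn.ne'
  have h2 := div_le_div_of_nonneg_right (DelSub.avg_lawEntropy_le hpd hpe m) hm.le
  rw [sub_div, mul_div_cancel_left₀ _ hm.ne'] at h2
  rw [Nat.succ_eq_add_one, DelSub.sum_W_mul, one_div_mul_eq_div]
  push_cast at h1 ⊢
  linarith
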